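/- Fix a real number $q$ with $0 < q < 1/2$. Let $E_0 = [0,1]$ and define recursively $E_k = qE_{k-1} \cup (qE_{k-1} + (1-q))$ for $k \ge 1$; the generalized Cantor set is $E = E(q) = \bigcap_{k=0}^{\infty} E_k$, regarded as a subset of $\mathbb{C}$. Let $D_0 = \{ z \in \mathbb{C} : |z - \tfrac12| \le \tfrac12 \}$ and define recursively $D_k = qD_{k-1} \cup (qD_{k-1} + 1 - q)$ for $k \ge 1$; thus $D_k$ is the union of the $2^k$ closed disks of radius $q^k/2$ centred at the midpoints of the $2^k$ intervals of which $E_k$ consists. For a compact set $K \subseteq \mathbb{C}$ let $\operatorname{cap}(K) = \sup_{\mu} \exp\left( \iint \log|z-w| \, d\mu(z) \, d\mu(w) \right)$ denote its logarithmic capacity, where $\mu$ runs over the Borel probability measures on $\mathbb{C}$ with support contained in $K$ (and $\exp(-\infty) = 0$). Then $$\bigcap_{k=0}^{\infty} D_k = E \quad \text{and} \quad \operatorname{cap}(E) = \lim_{k \to \infty} \operatorname{cap}(D_k).$$ -/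

import Mathlib

open MeasureTheory Filter Topology
open scoped ENNReal

/-- The `k`-th stage of the construction of the generalized Cantor set with ratio `q`, as a
subset of the real line: `E₀ = [0,1]` and `E_{k+1} = q E_k ∪ (q E_k + (1 - q))`. -/
def cantorStage (q : ℝ) : ℕ → Set ℝ
  | 0 => Set.Icc 0 1
  | k + 1 => (fun x : ℝ => q * x) '' cantorStage q k ∪
      (fun x : ℝ => q * x + (1 - q)) '' cantorStage q k

/-- The generalized Cantor set `E(q) = ⋂ₖ E_k`, regarded as a subset of the complex plane. -/
def genCantorSet (q : ℝ) : Set ℂ :=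
  (fun x : ℝ => (x : ℂ)) '' ⋂ k : ℕ, cantorStage q k

/-- The sets of disks: `D₀` is the closed disk with center `1/2` and radius `1/2`, and
`D_{k+1} = q D_k ∪ (q D_k + 1 - q)`. -/
def cantorDisks (q : ℝ) : ℕ → Set ℂ
  | 0 => Metric.closedBall (1 / 2 : ℂ) (1 / 2)
  | k + 1 => (fun z : ℂ => (q : ℂ) * z) '' cantorDisks q k ∪
      (fun z : ℂ => (q : ℂ) * z + (1 - (q : ℂ))) '' cantorDisks q k

/-- The logarithmic energy `I(μ) = ∬ log |z - w| dμ(w) dμ(z)`, as an extended real number: the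
integral of the positive part of the kernel minus the integral of its negative part. The kernel
takes the value `-∞` on the diagonal. If `μ` is finite and has compact support, then the first
integral is finite, so that the difference is never of the form `∞ - ∞`. -/
noncomputable def logEnergy (μ : Measure ℂ) : EReal :=
  ((∫⁻ z, ∫⁻ w, (ENNReal.log (edist z w)).toENNReal ∂μ ∂μ : ℝ≥0∞) : EReal) -
    ((∫⁻ z, ∫⁻ w, (-ENNReal.log (edist z w)).toENNReal ∂μ ∂μ : ℝ≥0∞) : EReal)

/-- The logarithmic capacity `cap(K) = sup_μ exp(I(μ))`, where `μ` runs over the Borel probability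
measures on `ℂ` whose support is a compact subset of `K`, with `exp(-∞) = 0`. It is finite for
bounded `K`, see `logCapacity_lt_top`. -/
noncomputable def logCapacity (K : Set ℂ) : ℝ≥0∞ :=
  ⨆ (μ : Measure ℂ) (_ : IsProbabilityMeasure μ) (_ : IsCompact μ.support) (_ : μ.support ⊆ K),
    EReal.exp (logEnergy μ)

theorem logCapacity_lt_top {K : Set ℂ} (hK : Bornology.IsBounded K) : logCapacity K < ⊤ := by
  have hC : Metric.ediam K < ⊤ := lt_top_iff_ne_top.2 hK.ediam_ne_top
  set C := Metric.ediam K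
  have hfin : (ENNReal.log C).toENNReal < ⊤ := by
    rw [lt_top_iff_ne_top, ne_eq, EReal.toENNReal_eq_top_iff, ENNReal.log_eq_top_iff]
    exact hC.ne
  refine lt_of_le_of_lt (b := EReal.exp ((ENNReal.log C).toENNReal : EReal)) ?_ ?_
  · refine iSup_le fun μ => iSup_le fun _ => iSup_le fun _ => iSup_le fun hs => ?_
    refine EReal.exp_monotone ?_
    have hae : ∀ᵐ z ∂μ, z ∈ K :=
      mem_of_superset (show μ.support ∈ ae μ from Measure.support_mem_ae) hs
    refine (EReal.sub_le_sub le_rfl (EReal.coe_ennreal_nonneg _)).trans ?_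
    rw [sub_zero]
    rw [EReal.coe_ennreal_le_coe_ennreal_iff]
    calc ∫⁻ z, ∫⁻ w, (ENNReal.log (edist z w)).toENNReal ∂μ ∂μ
        ≤ ∫⁻ _, ∫⁻ _, (ENNReal.log C).toENNReal ∂μ ∂μ := by
          refine lintegral_mono_ae ?_
          filter_upwards [hae] with z hz
          refine lintegral_mono_ae ?_
          filter_upwards [hae] with w hw
          exact EReal.toENNReal_le_toENNReal
            (ENNReal.log_monotone (Metric.edist_le_ediam_of_mem hz hw))
      _ = _ := by simp
  · rw [lt_top_iff_ne_top, ne_eq, EReal.exp_eq_top_iff]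
    simpa using hfin.ne

/-! The `D_k` are compact and decrease to `E`: real parts of points of `D_k` lie in `E_k`, while
imaginary parts are `O(q^k)`. It remains to see that capacity is continuous along such a sequence
(`tendsto_logCapacity_iInter`). Nearly optimal measures on the `D_k` have a weak limit point by
Prokhorov, and it is carried by the intersection. Since `D_0` has diameter at most one, the kernel
`-log |z - w|` is nonnegative there; it is continuous into `[0, ∞]`, so its double integral is
weakly lower semicontinuous and the limit measure does at least as well. -/

theorem lintegral_le_liminf_lintegral_of_continuous {Ω : Type*} [TopologicalSpace Ω]
    [MeasurableSpace Ω] [OpensMeasurableSpace Ω] {μ : Measure Ω} {μs : ℕ → Measure Ω}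
    {f : Ω → ℝ≥0∞} (hf : Continuous f)
    (h : ∀ G, IsOpen G → μ G ≤ atTop.liminf fun i => μs i G) :
    ∫⁻ x, f x ∂μ ≤ atTop.liminf fun i => ∫⁻ x, f x ∂μs i := by
  -- Truncation makes `f` finite, so that the real-valued portmanteau inequality applies; monotone
  -- convergence removes it.
  have hsup : ∀ x, f x = ⨆ n : ℕ, min (f x) n := fun x => by
    have hm : Monotone fun n : ℕ => min (f x) (n : ℝ≥0∞) := fun a b hab =>
      min_le_min le_rfl (Nat.cast_le.2 hab)
    refine (tendsto_nhds_unique (tendsto_atTop_iSup hm) ?_).symm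
    simpa using (tendsto_const_nhds (x := f x)).min ENNReal.tendsto_nat_nhds_top
  have hint : ∫⁻ x, f x ∂μ = ⨆ n : ℕ, ∫⁻ x, min (f x) n ∂μ := by
    rw [← lintegral_iSup (fun n => hf.measurable.min measurable_const)
      fun a b hab x => min_le_min le_rfl (Nat.cast_le.2 hab)]
    exact lintegral_congr hsup
  rw [hint]
  refine iSup_le fun n => ?_
  have hne : ∀ x, min (f x) (n : ℝ≥0∞) ≠ ⊤ := fun x =>
    ((min_le_right _ _).trans_lt (ENNReal.natCast_lt_top n)).ne
  have hcont : Continuous fun x => (min (f x) (n : ℝ≥0∞)).toReal :=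
    ENNReal.continuousOn_toReal.comp_continuous (hf.min continuous_const) hne
  have key := lintegral_le_liminf_lintegral_of_forall_isOpen_measure_le_liminf_measure
    hcont (fun x => ENNReal.toReal_nonneg) h
  simp only [ENNReal.ofReal_toReal (hne _)] at key
  exact key.trans (liminf_le_liminf (Eventually.of_forall fun i =>
    lintegral_mono fun x => min_le_left _ _))

theorem lintegral_prod_le_liminf_of_tendsto {X : Type*} [TopologicalSpace X]
    [TopologicalSpace.PseudoMetrizableSpace X] [SecondCountableTopology X] [MeasurableSpace X]
    [BorelSpace X] {μ : ℕ → ProbabilityMeasure X} {ν : ProbabilityMeasure X}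
    (h : Tendsto μ atTop (𝓝 ν)) {f : X × X → ℝ≥0∞} (hf : Continuous f) :
    ∫⁻ p, f p ∂((ν : Measure X).prod ν) ≤
      atTop.liminf fun n => ∫⁻ p, f p ∂((μ n : Measure X).prod (μ n)) := by
  have hprod : Tendsto (fun n => (μ n).prod (μ n)) atTop (𝓝 (ν.prod ν)) :=
    (ProbabilityMeasure.continuous_prod.tendsto (ν, ν)).comp (h.prodMk_nhds h)
  refine lintegral_le_liminf_lintegral_of_continuous hf fun G hG => ?_
  simpa only [ProbabilityMeasure.toMeasure_prod] using
    ProbabilityMeasure.le_liminf_measure_open_of_tendsto hprod hG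

theorem continuous_neg_log_edist :
    Continuous fun p : ℂ × ℂ => (-ENNReal.log (edist p.1 p.2)).toENNReal :=
  EReal.continuous_toENNReal.comp
    (continuous_neg.comp (ENNReal.continuous_log.comp (continuous_fst.edist continuous_snd)))

/-- Distances in `K` are at most one, so the positive part of the kernel vanishes almost everywhere.
-/
theorem logEnergy_eq_neg_lintegral_prod {K : Set ℂ} (hK : Metric.ediam K ≤ 1) (μ : Measure ℂ)
    [SFinite μ] (hμ : μ.support ⊆ K) :
    logEnergy μ =
      -((∫⁻ p, (-ENNReal.log (edist p.1 p.2)).toENNReal ∂(μ.prod μ) : ℝ≥0∞) : EReal) := by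
  have hae : ∀ᵐ z ∂μ, z ∈ K :=
    mem_of_superset (show μ.support ∈ ae μ from Measure.support_mem_ae) hμ
  have hpos : ∫⁻ z, ∫⁻ w, (ENNReal.log (edist z w)).toENNReal ∂μ ∂μ = 0 := by
    rw [← nonpos_iff_eq_zero]
    calc ∫⁻ z, ∫⁻ w, (ENNReal.log (edist z w)).toENNReal ∂μ ∂μ
        ≤ ∫⁻ _, ∫⁻ _, 0 ∂μ ∂μ := by
          refine lintegral_mono_ae ?_
          filter_upwards [hae] with z hz
          refine lintegral_mono_ae ?_
          filter_upwards [hae] with w hw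
          rw [EReal.toENNReal_of_nonpos]
          exact ENNReal.log_le_zero_iff.2 ((Metric.edist_le_ediam_of_mem hz hw).trans hK)
      _ = 0 := by simp
  rw [logEnergy, hpos, lintegral_prod _ continuous_neg_log_edist.measurable.aemeasurable]
  simp

theorem logCapacity_mono {K L : Set ℂ} (h : K ⊆ L) : logCapacity K ≤ logCapacity L :=
  iSup_mono fun _ => iSup_mono fun _ => iSup_mono fun _ => iSup_mono' fun hs => ⟨hs.trans h, le_rfl⟩

theorem exists_subseq_tendsto_of_support_subset {K : Set ℂ} (hK : IsCompact K)
    (μ : ℕ → ProbabilityMeasure ℂ) (hμ : ∀ n, (μ n : Measure ℂ).support ⊆ K) :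
    ∃ ν : ProbabilityMeasure ℂ, ∃ φ : ℕ → ℕ, StrictMono φ ∧ Tendsto (μ ∘ φ) atTop (𝓝 ν) := by
  have htight : IsTightMeasureSet
      {((ρ : ProbabilityMeasure ℂ) : Measure ℂ) | ρ ∈ Set.range μ} := by
    rw [isTightMeasureSet_iff_exists_isCompact_measure_compl_le]
    rintro ε -
    -- The same `K` serves for every `ε`, as its complement is null for each measure.
    refine ⟨K, hK, ?_⟩
    rintro _ ⟨_, ⟨n, rfl⟩, rfl⟩
    exact ((measure_mono (Set.compl_subset_compl.2 (hμ n))).trans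
      Measure.measure_compl_support.le).trans zero_le
  obtain ⟨ν, -, φ, hφ, h⟩ := (isCompact_closure_of_isTightMeasureSet htight).tendsto_subseq
    fun n => subset_closure (Set.mem_range_self n)
  exact ⟨ν, φ, hφ, h⟩

theorem support_subset_of_tendsto {K : Set ℂ} (hK : IsClosed K) {μ : ℕ → ProbabilityMeasure ℂ}
    {ν : ProbabilityMeasure ℂ} (h : Tendsto μ atTop (𝓝 ν))
    (hμ : ∀ᶠ n in atTop, (μ n : Measure ℂ).support ⊆ K) : (ν : Measure ℂ).support ⊆ K := by
  refine Measure.support_subset_of_isClosed hK ?_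
  rw [mem_ae_iff, ← nonpos_iff_eq_zero]
  refine (ProbabilityMeasure.le_liminf_measure_open_of_tendsto h hK.isOpen_compl).trans ?_
  have : ∀ᶠ n in atTop, (μ n : Measure ℂ) Kᶜ = 0 := hμ.mono fun n hn =>
    measure_mono_null (Set.compl_subset_compl.2 hn) Measure.measure_compl_support
  rw [liminf_congr this]
  simp

/-- The logarithmic capacity is continuous along decreasing sequences of compact sets of
diameter at most one. -/
theorem tendsto_logCapacity_iInter {K : ℕ → Set ℂ} (hanti : Antitone K)
    (hK : ∀ n, IsCompact (K n)) (hdiam : Metric.ediam (K 0) ≤ 1) :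
    Tendsto (fun n => logCapacity (K n)) atTop (𝓝 (logCapacity (⋂ n, K n))) := by
  have hmono : Antitone fun n => logCapacity (K n) := fun a b hab => logCapacity_mono (hanti hab)
  suffices h : ⨅ n, logCapacity (K n) = logCapacity (⋂ n, K n) from
    h ▸ tendsto_atTop_iInf hmono
  -- Working with an arbitrary `c` below the infimum avoids having to show that the suprema are
  -- attained.
  refine le_antisymm (le_of_forall_lt_imp_le_of_dense fun c hc => ?_)
    (le_iInf fun n => logCapacity_mono (Set.iInter_subset K n))
  have hex : ∀ n, ∃ μ : ProbabilityMeasure ℂ, (μ : Measure ℂ).support ⊆ K n ∧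
      c < EReal.exp (logEnergy μ) := fun n => by
    have h := hc.trans_le (iInf_le _ n)
    simp only [logCapacity, lt_iSup_iff] at h
    obtain ⟨μ, hμ, -, hs, h⟩ := h
    exact ⟨⟨μ, hμ⟩, hs, h⟩
  choose μ hs hμ using hex
  obtain ⟨ν, φ, hφ, hν⟩ := exists_subseq_tendsto_of_support_subset (hK 0) μ
    fun n => (hs n).trans (hanti n.zero_le)
  have hsupp : ∀ n, (ν : Measure ℂ).support ⊆ K n := fun n =>
    support_subset_of_tendsto (hK n).isClosed hν <| (eventually_ge_atTop n).mono fun m hm =>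
      (hs (φ m)).trans (hanti (hm.trans (hφ.id_le m)))
  have hE : ∀ n, ((∫⁻ p, (-ENNReal.log (edist p.1 p.2)).toENNReal
      ∂((μ n : Measure ℂ).prod (μ n)) : ℝ≥0∞) : EReal) ≤ -ENNReal.log c := fun n => by
    have h := ENNReal.log_strictMono (hμ n)
    rw [EReal.log_exp, logEnergy_eq_neg_lintegral_prod hdiam _ ((hs n).trans (hanti n.zero_le))]
      at h
    exact (EReal.lt_neg_comm.1 h).le
  -- This sign ensures that `toENNReal` loses nothing when the bound returns to `EReal`.
  have hc0 : 0 ≤ -ENNReal.log c := (EReal.coe_ennreal_nonneg _).trans (hE 0)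
  have hlim : ∫⁻ p, (-ENNReal.log (edist p.1 p.2)).toENNReal ∂((ν : Measure ℂ).prod ν) ≤
      (-ENNReal.log c).toENNReal := by
    have hbound : ∀ n, ∫⁻ p, (-ENNReal.log (edist p.1 p.2)).toENNReal
        ∂((μ (φ n) : Measure ℂ).prod (μ (φ n))) ≤ (-ENNReal.log c).toENNReal := fun n => by
      have h := EReal.toENNReal_le_toENNReal (hE (φ n))
      rwa [EReal.toENNReal_coe] at h
    exact (lintegral_prod_le_liminf_of_tendsto hν continuous_neg_log_edist).trans
      ((liminf_le_liminf (Eventually.of_forall hbound)).trans_eq (liminf_const _))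
  have hνE : ENNReal.log c ≤ logEnergy ν := by
    rw [logEnergy_eq_neg_lintegral_prod hdiam _ (hsupp 0), EReal.le_neg]
    rw [← EReal.coe_ennreal_le_coe_ennreal_iff, EReal.coe_toENNReal hc0] at hlim
    exact hlim
  calc c = EReal.exp (ENNReal.log c) := (ENNReal.exp_log c).symm
    _ ≤ EReal.exp (logEnergy ν) := EReal.exp_monotone hνE
    _ ≤ logCapacity (⋂ n, K n) :=
      le_iSup_of_le (ν : Measure ℂ) <| le_iSup_of_le inferInstance <|
        le_iSup_of_le ((hK 0).of_isClosed_subset Measure.isClosed_support (hsupp 0)) <|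
          le_iSup_of_le (Set.subset_iInter hsupp) le_rfl

theorem isCompact_cantorDisks (q : ℝ) (k : ℕ) : IsCompact (cantorDisks q k) := by
  induction k with
  | zero => exact isCompact_closedBall _ _
  | succ k ih => exact (ih.image (by fun_prop)).union (ih.image (by fun_prop))

theorem antitone_cantorDisks {q : ℝ} (hq0 : 0 ≤ q) (hq : q ≤ 1) : Antitone (cantorDisks q) := by
  refine antitone_nat_of_succ_le fun k => ?_
  induction k with
  | zero =>
    have hn : ‖(q : ℂ)‖ = q := by simp [abs_of_nonneg hq0]
    have hn' : ‖(1 - q : ℂ)‖ = 1 - q := by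
      rw [← Complex.ofReal_one, ← Complex.ofReal_sub, Complex.norm_real, Real.norm_eq_abs,
        abs_of_nonneg (by linarith)]
    have hhalf : ‖(1 / 2 : ℂ)‖ = 1 / 2 := by simp
    rintro _ (⟨z, hz, rfl⟩ | ⟨z, hz, rfl⟩)
    all_goals
      have hz : ‖z - 1 / 2‖ ≤ 1 / 2 := by simpa [cantorDisks, dist_eq_norm] using hz
      simp only [cantorDisks, mem_closedBall_iff_norm]
    -- Each image disk has radius `q/2` and centre at distance `(1 - q)/2` from `1/2`; these add up
    -- to exactly `1/2`.
    · calc ‖q * z - 1 / 2‖ = ‖q * (z - 1 / 2) - (1 - q) * (1 / 2)‖ := by ring_nf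
        _ ≤ ‖q * (z - 1 / 2)‖ + ‖(1 - q : ℂ) * (1 / 2)‖ := norm_sub_le _ _
        _ ≤ 1 / 2 := by rw [norm_mul, norm_mul, hn, hn', hhalf]; nlinarith
    · calc ‖q * z + (1 - q) - 1 / 2‖ = ‖q * (z - 1 / 2) + (1 - q) * (1 / 2)‖ := by ring_nf
        _ ≤ ‖q * (z - 1 / 2)‖ + ‖(1 - q : ℂ) * (1 / 2)‖ := norm_add_le _ _
        _ ≤ 1 / 2 := by rw [norm_mul, norm_mul, hn, hn', hhalf]; nlinarith
  | succ k ih => exact Set.union_subset_union (Set.image_mono ih) (Set.image_mono ih)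

theorem ofReal_mem_cantorDisks {q : ℝ} {k : ℕ} {x : ℝ} (hx : x ∈ cantorStage q k) :
    (x : ℂ) ∈ cantorDisks q k := by
  induction k generalizing x with
  | zero =>
    have h : |x - 1 / 2| ≤ 1 / 2 := abs_le.2 ⟨by linarith [hx.1], by linarith [hx.2]⟩
    rw [← Real.norm_eq_abs, ← Complex.norm_real] at h
    simpa [cantorDisks, dist_eq_norm] using h
  | succ k ih =>
    rcases hx with ⟨y, hy, rfl⟩ | ⟨y, hy, rfl⟩
    · exact Or.inl ⟨y, ih hy, by simp⟩
    · exact Or.inr ⟨y, ih hy, by simp⟩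

theorem re_mem_cantorStage {q : ℝ} {k : ℕ} {z : ℂ} (hz : z ∈ cantorDisks q k) :
    z.re ∈ cantorStage q k := by
  induction k generalizing z with
  | zero =>
    have hz : ‖z - 1 / 2‖ ≤ 1 / 2 := by simpa [cantorDisks, dist_eq_norm] using hz
    have h := abs_le.1 ((Complex.abs_re_le_norm _).trans hz)
    norm_num at h
    exact ⟨by linarith [h.1], by linarith [h.2]⟩
  | succ k ih =>
    rcases hz with ⟨w, hw, rfl⟩ | ⟨w, hw, rfl⟩
    · exact Or.inl ⟨w.re, ih hw, by simp⟩
    · exact Or.inr ⟨w.re, ih hw, by simp⟩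

/-- Both maps scale imaginary parts by `q`, the translation being real. The sharp factor `1/2` is
dropped, as only decay matters. -/
theorem abs_im_le_of_mem_cantorDisks {q : ℝ} {k : ℕ} {z : ℂ} (hz : z ∈ cantorDisks q k) :
    |z.im| ≤ |q| ^ k := by
  induction k generalizing z with
  | zero =>
    have hz : ‖z - 1 / 2‖ ≤ 1 / 2 := by simpa [cantorDisks, dist_eq_norm] using hz
    have h := (Complex.abs_im_le_norm _).trans hz
    norm_num at h
    rw [pow_zero]
    linarith
  | succ k ih =>
    rcases hz with ⟨w, hw, rfl⟩ | ⟨w, hw, rfl⟩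
    all_goals
      simp only [Complex.add_im, Complex.sub_im, Complex.one_im, Complex.ofReal_im, sub_zero,
        add_zero, Complex.im_ofReal_mul, abs_mul, pow_succ']
      exact mul_le_mul_of_nonneg_left (ih hw) (abs_nonneg q)

theorem iInter_cantorDisks {q : ℝ} (hq : |q| < 1) : ⋂ k, cantorDisks q k = genCantorSet q := by
  ext z
  simp only [genCantorSet, Set.mem_iInter, Set.mem_image]
  constructor
  · refine fun h => ⟨z.re, fun k => re_mem_cantorStage (h k), Complex.ext rfl ?_⟩
    have him : |z.im| ≤ 0 := ge_of_tendsto' (tendsto_pow_atTop_nhds_zero_of_lt_one (abs_nonneg q) hq)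
      fun k => abs_im_le_of_mem_cantorDisks (h k)
    simpa using (abs_nonpos_iff.1 him).symm
  · rintro ⟨x, hx, rfl⟩ k
    exact ofReal_mem_cantorDisks (hx k)

theorem theorem3p1 (q : ℝ) (hq0 : 0 < q) (hq : q < 1 / 2) :
    (⋂ k : ℕ, cantorDisks q k) = genCantorSet q ∧
      Tendsto (fun k : ℕ => logCapacity (cantorDisks q k)) atTop
        (𝓝 (logCapacity (genCantorSet q))) := by
  have hI := iInter_cantorDisks (q := q) (by rw [abs_of_pos hq0]; linarith)
  refine ⟨hI, hI ▸ tendsto_logCapacity_iInter (antitone_cantorDisks hq0.le (by linarith))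
    (isCompact_cantorDisks q) ?_⟩
  refine Metric.ediam_le fun x hx y hy => ?_
  rw [edist_dist, ENNReal.ofReal_le_one]
  linarith [dist_triangle_right x y (1 / 2), Metric.mem_closedBall.1 hx, Metric.mem_closedBall.1 hy]
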